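/- **Theorem 6.2 (monotonicity theorem).** Let $x=(x_1,\dots,x_n)$ be the standard coordinates on $\mathbb R^n$ and $\xi=(\xi_1,\dots,\xi_n)$ a second copy of them. A superform of bidegree $(p,q)$ on an open set $U\subset\mathbb R^n$ is an expression $a=\sum_{|I|=p,|K|=q}a_{I,K}(x)\,dx_I\wedge d\xi_K$ with smooth coefficients depending on $x\in U$ only, where all the $dx_i,d\xi_k$ anticommute, and $da=\sum_k dx_k\wedge\partial a/\partial x_k$. Let $J$ be the algebra homomorphism, linear over functions, with $J(dx_i)=d\xi_i$ and $J(d\xi_i)=-dx_i$, write $\alpha^{\#}=J\alpha$ for $(1,0)$-forms $\alpha$, and put $\beta=\sum_i dx_i\wedge d\xi_i$. A supercurrent of bidimension $(p,q)$ on $U$ is a continuous linear functional $T$ on the space of superforms of bidegree $(p,q)$ with compact support in $U$ (with the usual test function topology); set $(T\wedge b).a=T.(b\wedge a)$ for constant forms $b$, and $dT.a=(-1)^{\deg a}\,T.da$. Let $m\ge 1$, let $U$ be an open neighbourhood of the origin in $\mathbb R^n$, and let $T$ be a minimal supercurrent of bidimension $(m,m)$ on $U$, i.e. $T$ is - symmetric: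 $T.(Ja)=T.a$ for all test forms $a$ of bidegree $(m,m)$; - (weakly) positive: $T.(\alpha_1\wedge\alpha_1^{\#}\wedge\dots\wedge\alpha_m\wedge\alpha_m^{\#})\ge 0$ for all smooth $(1,0)$-forms $\alpha_1,\dots,\alpha_m$ with compact support in $U$; - minimal: $dT\wedge\beta^{m-1}=0$ on $U$. Then $T\wedge\beta^m/m!$ is a positive Radon measure on $U$, and $$ r\longmapsto r^{-m}\int_{|x|<r}T\wedge\beta^m/m! $$ is nondecreasing on the set of all $r>0$ for which the ball $\{|x|<r\}$ is contained in $U$ (the value $+\infty$ being allowed if the closed ball is not contained in $U$). -/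

import Mathlib

open MeasureTheory TopologicalSpace
open scoped Distributions Nat

/-- The real algebra of constant superforms on `ℝⁿ`, i.e. the exterior algebra of
`T^*(E_s) = T^*(E_0) ⊕ T^*(E_1)`.  A covector is written as the pair of its coordinates in the bases
`dx_1, …, dx_n` and `dξ_1, …, dξ_n`; the product of the algebra is the wedge product. -/
abbrev SuperAlg (n : ℕ) : Type :=
  ExteriorAlgebra ℝ ((Fin n → ℝ) × (Fin n → ℝ))

namespace SuperAlg

instance instFinite (n : ℕ) : Module.Finite ℝ (SuperAlg n) := by
  let M := (Fin n → ℝ) × (Fin n → ℝ)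
  have htop : (⨆ k : ℕ, ⋀[ℝ]^k M) = ⊤ :=
    (DirectSum.Decomposition.isInternal (fun k : ℕ => ⋀[ℝ]^k M)).submodule_iSup_eq_top
  have hbot : ∀ k : ℕ, Module.finrank ℝ M < k → (⋀[ℝ]^k M) = ⊥ := by
    intro k hk
    rw [← Submodule.finrank_eq_zero (R := ℝ), exteriorPower.finrank_eq]
    exact Nat.choose_eq_zero_of_lt hk
  have hfin : (⨆ k : Fin (Module.finrank ℝ M + 1), ⋀[ℝ]^(k : ℕ) M) = ⊤ := by
    rw [eq_top_iff, ← htop]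
    refine iSup_le fun k => ?_
    by_cases hk : Module.finrank ℝ M < k
    · rw [hbot k hk]
      exact bot_le
    · exact le_iSup (fun j : Fin (Module.finrank ℝ M + 1) => ⋀[ℝ]^(j : ℕ) M)
        ⟨k, by omega⟩
  refine Module.finite_def.mpr ?_
  rw [← hfin]
  exact Submodule.fg_iSup _ fun k => Module.Finite.iff_fg.mp inferInstance

/-- The norm of the coordinates in some basis.  The algebra is finite dimensional, so every norm
gives the same topology and the same smooth maps. -/
noncomputable instance instNormedAddCommGroup (n : ℕ) : NormedAddCommGroup (SuperAlg n) :=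
  NormedAddCommGroup.induced (SuperAlg n) (Fin (Module.finrank ℝ (SuperAlg n)) → ℝ)
    (Module.finBasis ℝ (SuperAlg n)).equivFun.toLinearMap
    (Module.finBasis ℝ (SuperAlg n)).equivFun.injective

noncomputable instance instNormedSpace (n : ℕ) : NormedSpace ℝ (SuperAlg n) :=
  NormedSpace.induced ℝ (SuperAlg n) (Fin (Module.finrank ℝ (SuperAlg n)) → ℝ)
    (Module.finBasis ℝ (SuperAlg n)).equivFun.toLinearMap

variable {n : ℕ}

/-- The covector `∑ i, a i dx_i`. -/
noncomputable def ofX (n : ℕ) : (Fin n → ℝ) →ₗ[ℝ] SuperAlg n :=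
  ExteriorAlgebra.ι ℝ ∘ₗ LinearMap.inl ℝ (Fin n → ℝ) (Fin n → ℝ)

/-- The covector `∑ i, a i dξ_i`. -/
noncomputable def ofXi (n : ℕ) : (Fin n → ℝ) →ₗ[ℝ] SuperAlg n :=
  ExteriorAlgebra.ι ℝ ∘ₗ LinearMap.inr ℝ (Fin n → ℝ) (Fin n → ℝ)

noncomputable def dx (i : Fin n) : SuperAlg n := ofX n (Pi.single i 1)

noncomputable def dxi (i : Fin n) : SuperAlg n := ofXi n (Pi.single i 1)

/-- The span of the `dx_I ∧ dξ_J` with `|I| = p` and `|J| = q`. -/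
noncomputable def bidegree (n p q : ℕ) : Submodule ℝ (SuperAlg n) :=
  LinearMap.range (ofX n) ^ p * LinearMap.range (ofXi n) ^ q

/-- The complex structure: the algebra homomorphism with `J dx_i = dξ_i` and `J dξ_i = - dx_i`. -/
noncomputable def J (n : ℕ) : SuperAlg n →ₐ[ℝ] SuperAlg n :=
  ExteriorAlgebra.map
    ((-(LinearMap.snd ℝ (Fin n → ℝ) (Fin n → ℝ))).prod (LinearMap.fst ℝ (Fin n → ℝ) (Fin n → ℝ)))

/-- The Kähler form `β = ∑ dx_i ∧ dξ_i`. -/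
noncomputable def beta (n : ℕ) : SuperAlg n := ∑ i : Fin n, dx i * dxi i

/-- A linear endomorphism of the (finite-dimensional) algebra as a continuous linear map. -/
noncomputable def clm (L : SuperAlg n →ₗ[ℝ] SuperAlg n) : SuperAlg n →L[ℝ] SuperAlg n :=
  L.toContinuousLinearMap

end SuperAlg

/-- Smooth superforms on `ℝⁿ` with compact support in the open set `U` (of all bidegrees), with the
usual topology of test functions. -/
abbrev TestForm {n : ℕ} (U : Opens (EuclideanSpace ℝ (Fin n))) : Type :=
  𝓓(U, SuperAlg n)

namespace TestForm

variable {n : ℕ} {U : Opens (EuclideanSpace ℝ (Fin n))}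

/-- A linear endomorphism of the algebra applied pointwise, `(map L a)(x) = L (a x)`. -/
noncomputable def map (L : SuperAlg n →ₗ[ℝ] SuperAlg n) : TestForm U →L[ℝ] TestForm U :=
  TestFunction.postcompCLM (SuperAlg.clm L)

/-- Left wedge product with a constant form, `a ↦ b ∧ a`. -/
noncomputable def constWedge (b : SuperAlg n) : TestForm U →L[ℝ] TestForm U :=
  map (LinearMap.mulLeft ℝ b)

/-- The exterior derivative `da = ∑ k, dx_k ∧ ∂a/∂x_k`. -/
noncomputable def d : TestForm U →L[ℝ] TestForm U :=
  ∑ k : Fin n, (constWedge (SuperAlg.dx k)).comp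
    (TestFunction.lineDerivCLM ℝ (EuclideanSpace.single k (1 : ℝ)) : TestForm U →L[ℝ] TestForm U)

/-- The sign operator: multiplication by `(-1) ^ k` on forms of total degree `k`. -/
noncomputable def sign : TestForm U →L[ℝ] TestForm U :=
  map (CliffordAlgebra.involute (Q := (0 : QuadraticForm ℝ ((Fin n → ℝ) × (Fin n → ℝ))))).toLinearMap

/-- A test function seen as a superform of bidegree `(0, 0)`. -/
noncomputable def ofFun : 𝓓(U, ℝ) →L[ℝ] TestForm U :=
  TestFunction.postcompCLM (Algebra.linearMap ℝ (SuperAlg n)).toContinuousLinearMap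

end TestForm

/-- Supercurrents on `U`: continuous linear functionals on the space of test superforms;
`T a` is thought of as the superintegral of `T ∧ a`. -/
abbrev Supercurrent {n : ℕ} (U : Opens (EuclideanSpace ℝ (Fin n))) : Type :=
  TestForm U →L[ℝ] ℝ

namespace Supercurrent

variable {n : ℕ} {U : Opens (EuclideanSpace ℝ (Fin n))}

/-- `T` is a functional on forms of bidegree `(p, q)`, extended by zero to the other bidegrees. -/
def HasBidimension (p q : ℕ) (T : Supercurrent U) : Prop :=
  ∀ (p' q' : ℕ), (p', q') ≠ (p, q) →
    ∀ a : TestForm U, (∀ x, a x ∈ SuperAlg.bidegree n p' q') → T a = 0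

/-- `(T ∧ b).a = T.(b ∧ a)` for a constant form `b`. -/
noncomputable def wedge (T : Supercurrent U) (b : SuperAlg n) : Supercurrent U :=
  T.comp (TestForm.constWedge b)

/-- `dT.a = (-1) ^ deg a * T.(da)`.  If `T` has degree `k`, then `dT` is tested on forms with
`deg a = 2n - k - 1`, and the sign is the usual `(-1) ^ (k + 1)`. -/
noncomputable def d (T : Supercurrent U) : Supercurrent U :=
  T.comp (TestForm.d.comp TestForm.sign)

/-- `J`-invariance; for bidimension `(m, m)` it says that the coefficients satisfy
`T_{I,K} = T_{K,I}`. -/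
def IsSymmetric (T : Supercurrent U) : Prop :=
  ∀ a : TestForm U, T (TestForm.map (SuperAlg.J n).toLinearMap a) = T a

/-- Weak positivity: `T.(α_1 ∧ α_1^# ∧ … ∧ α_m ∧ α_m^#) ≥ 0` for all smooth `(1,0)`-forms `α_j` with
compact support in `U`, where `α^# = J α`.  The form `a` below is that product. -/
def IsPositive (m : ℕ) (T : Supercurrent U) : Prop :=
  ∀ (α : Fin m → 𝓓(U, Fin n → ℝ)) (a : TestForm U),
    (∀ x, a x = (List.ofFn fun j : Fin m =>
      SuperAlg.ofX n (α j x) * SuperAlg.J n (SuperAlg.ofX n (α j x))).prod) →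
    0 ≤ T a

/-- Minimal supercurrents of bidimension `(m, m)`, for `m ≥ 1`. -/
structure IsMinimal (m : ℕ) (T : Supercurrent U) : Prop where
  hasBidimension : T.HasBidimension m m
  isSymmetric : T.IsSymmetric
  isPositive : T.IsPositive m
  closed : T.d.wedge (SuperAlg.beta n ^ (m - 1)) = 0

/-- `μ` restricted to `U` is a Radon measure which represents the current `T ∧ β^m / m!`, i.e.
`∫ f dμ = (T ∧ β^m / m!).f` for every test function `f` on `U`. -/
def IsMassMeasure (m : ℕ) (T : Supercurrent U) (μ : Measure (EuclideanSpace ℝ (Fin n))) : Prop :=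
  (∀ K : Set (EuclideanSpace ℝ (Fin n)), IsCompact K → K ⊆ U → μ K < ⊤) ∧
  ∀ f : 𝓓(U, ℝ),
    T.wedge ((m ! : ℝ)⁻¹ • SuperAlg.beta n ^ m) (TestForm.ofFun f) = ∫ x, f x ∂μ

end Supercurrent

/-! Minimality says that `T ∧ β^(m-1)` vanishes on `d` of a compactly supported `(0,1)`-form, which
is the first variation formula for the corresponding vector field. For the field `h(|x|²) x` it
reads `T.(h β^m + 2 h' β^(m-1) ∧ α ∧ α^#) = 0` with `α = ∑ x_i dx_i`.

By Lagrange's identity `|α|² β - α ∧ α^#` is a sum of forms `γ ∧ γ^#`. Since `α ∧ α^#` is central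
and squares to zero, the `m`-th power of this form is
`|α|^(2m-2) (|α|² β^m - m β^(m-1) ∧ α ∧ α^#)`, so weak positivity of `T` yields
`m β^(m-1) ∧ α ∧ α^# ≤ |α|² β^m` when tested against `T`. With `μ = T ∧ β^m / m!`, it follows that
`∫ (m h + 2 t h')(|x|²) dμ ≤ 0` for every nonincreasing `h` which is constant near `0`.

For `0 < s < r`, the choice `h(t) = (max(t, s²)^(-m/2) - r^(-m))⁺` makes the integrand equal to
`m s^(-m) 1_{|x| < s} - m r^(-m) 1_{|x| < r}`, which is the monotonicity. A smoothing of `h` gives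
the same inequality for slightly perturbed radii. -/

open scoped ContDiff

/-! ### The algebra of constant superforms -/

theorem sum_pow_eq_sum_prod_ofFn {R ι : Type*} [Semiring R] [Fintype ι] (y : ι → R) (m : ℕ) :
    (∑ i, y i) ^ m = ∑ σ : Fin m → ι, (List.ofFn fun j => y (σ j)).prod := by
  simpa using (MultilinearMap.mkPiAlgebraFin ℕ m R).map_sum fun _ => y

theorem sub_pow_succ_of_commute_of_mul_self_eq_zero {R : Type*} [Ring R] {y s : R}
    (h : Commute y s) (hs : s * s = 0) (k : ℕ) :
    (y - s) ^ (k + 1) = y ^ (k + 1) - (k + 1) • (y ^ k * s) := by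
  induction k with
  | zero => simp
  | succ k ih =>
    have hys : y ^ k * s * y = y ^ (k + 1) * s := by
      rw [mul_assoc, ← h.eq, ← mul_assoc, pow_succ]
    have hss : y ^ k * s * s = 0 := by rw [mul_assoc, hs, mul_zero]
    calc (y - s) ^ (k + 1 + 1)
        = (y ^ (k + 1) - (k + 1) • (y ^ k * s)) * (y - s) := by rw [pow_succ, ih]
      _ = y ^ (k + 1 + 1) - y ^ (k + 1) * s - (k + 1) • (y ^ (k + 1) * s) := by
        rw [sub_mul, mul_sub, mul_sub, ← pow_succ, smul_mul_assoc, smul_mul_assoc, hys, hss,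
          smul_zero, sub_zero]
      _ = y ^ (k + 1 + 1) - (k + 1 + 1) • (y ^ (k + 1) * s) := by
        rw [add_smul (k + 1) 1, one_smul]
        abel

theorem commute_ι_mul_ι {R M : Type*} [CommRing R] [AddCommGroup M] [Module R M] (a b : M)
    (z : ExteriorAlgebra R M) : Commute (ExteriorAlgebra.ι R a * ExteriorAlgebra.ι R b) z := by
  have hswap (u v : M) : ExteriorAlgebra.ι R u * ExteriorAlgebra.ι R v =
      -(ExteriorAlgebra.ι R v * ExteriorAlgebra.ι R u) :=
    eq_neg_of_add_eq_zero_left (ExteriorAlgebra.ι_add_mul_swap u v)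
  induction z using ExteriorAlgebra.induction with
  | algebraMap r => exact (Algebra.commutes' r _).symm
  | ι c =>
    rw [commute_iff_eq, mul_assoc, hswap b c, mul_neg, ← mul_assoc, hswap a c, neg_mul, neg_neg,
      mul_assoc]
  | mul a b ha hb => exact ha.mul_right hb
  | add a b ha hb => exact ha.add_right hb

namespace SuperAlg

variable {n : ℕ}

theorem J_ofX (v : Fin n → ℝ) : J n (ofX n v) = ofXi n v := by
  simp [J, ofX, ofXi]

theorem ofX_eq_sum (v : Fin n → ℝ) : ofX n v = ∑ i, v i • dx i := by
  conv_lhs => rw [pi_eq_sum_univ' v]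
  simp only [map_sum, map_smul]
  refine Finset.sum_congr rfl fun i _ => ?_
  congr 2

theorem ofXi_eq_sum (v : Fin n → ℝ) : ofXi n v = ∑ i, v i • dxi i := by
  conv_lhs => rw [pi_eq_sum_univ' v]
  simp only [map_sum, map_smul]
  refine Finset.sum_congr rfl fun i _ => ?_
  congr 2

/-- The form `α ∧ α^#` of the constant `(1,0)`-form `α = ∑ i, v i dx_i`. -/
noncomputable def wedgeSharp (v : Fin n → ℝ) : SuperAlg n := ofX n v * ofXi n v

theorem beta_eq_sum_wedgeSharp : beta n = ∑ i, wedgeSharp (Pi.single i 1) := rfl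

theorem wedgeSharp_eq_sum (v : Fin n → ℝ) :
    wedgeSharp v = ∑ i, ∑ j, (v i * v j) • (dx i * dxi j) := by
  simp only [wedgeSharp, ofX_eq_sum, ofXi_eq_sum, Finset.sum_mul_sum, smul_mul_smul_comm]

theorem wedgeSharp_smul (r : ℝ) (v : Fin n → ℝ) : wedgeSharp (r • v) = r ^ 2 • wedgeSharp v := by
  simp only [wedgeSharp, map_smul, smul_mul_smul_comm, pow_two]

theorem commute_wedgeSharp (v : Fin n → ℝ) (z : SuperAlg n) : Commute (wedgeSharp v) z :=
  commute_ι_mul_ι _ _ z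

theorem commute_beta (z : SuperAlg n) : Commute (beta n) z :=
  Commute.sum_left _ _ _ fun i _ => commute_wedgeSharp (Pi.single i 1) z

theorem wedgeSharp_mul_self (v : Fin n → ℝ) : wedgeSharp v * wedgeSharp v = 0 := by
  have hξ : ofXi n v * ofXi n v = 0 := ExteriorAlgebra.ι_sq_zero _
  calc wedgeSharp v * (ofX n v * ofXi n v)
      = ofX n v * wedgeSharp v * ofXi n v := by
        rw [← mul_assoc, (commute_wedgeSharp v (ofX n v)).eq]
    _ = ofX n v * ofX n v * (ofXi n v * ofXi n v) := by simp only [wedgeSharp, mul_assoc]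
    _ = 0 := by rw [hξ, mul_zero]

theorem sum_wedgeSharp_lagrange (v : Fin n → ℝ) :
    ∑ p : Fin n × Fin n, wedgeSharp (v p.1 • Pi.single p.2 (1 : ℝ) - v p.2 • Pi.single p.1 1) =
      (2 : ℝ) • ((∑ i, v i ^ 2) • beta n - wedgeSharp v) := by
  have hexpand (i j : Fin n) : wedgeSharp (v i • Pi.single j (1 : ℝ) - v j • Pi.single i 1) =
      v i ^ 2 • (dx j * dxi j) - (v j * v i) • (dx j * dxi i) - (v i * v j) • (dx i * dxi j)
        + v j ^ 2 • (dx i * dxi i) := by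
    simp only [wedgeSharp, map_sub, map_smul, dx, dxi, sub_mul, mul_sub, smul_mul_smul_comm,
      ← pow_two]
    rw [mul_comm (v j) (v i)]
    abel
  have hdiag : ∑ i, ∑ j, v i ^ 2 • (dx j * dxi j) = (∑ i, v i ^ 2) • beta n := by
    simp only [← Finset.smul_sum, ← Finset.sum_smul, beta]
  simp only [Fintype.sum_prod_type, hexpand, Finset.sum_add_distrib, Finset.sum_sub_distrib]
  rw [Finset.sum_comm (f := fun i j => (v j * v i) • (dx j * dxi i)), ← wedgeSharp_eq_sum,
    Finset.sum_comm (f := fun i j => v j ^ 2 • (dx i * dxi i)), hdiag]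
  module

theorem smul_beta_sub_wedgeSharp_pow_succ (v : Fin n → ℝ) (r : ℝ) (p : ℕ) :
    (r • beta n - wedgeSharp v) ^ (p + 1) =
      r ^ p • (r • beta n ^ (p + 1) - ((p : ℝ) + 1) • (beta n ^ p * wedgeSharp v)) := by
  rw [sub_pow_succ_of_commute_of_mul_self_eq_zero (commute_wedgeSharp v (r • beta n)).symm
    (wedgeSharp_mul_self v), smul_pow, smul_pow, smul_sub, smul_smul, ← pow_succ, smul_mul_assoc,
    ← Nat.cast_smul_eq_nsmul ℝ, smul_comm]
  push_cast
  rfl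

theorem involute_beta_pow_mul_ofXi (p : ℕ) (v : Fin n → ℝ) :
    CliffordAlgebra.involute (Q := (0 : QuadraticForm ℝ ((Fin n → ℝ) × (Fin n → ℝ))))
      (beta n ^ p * ofXi n v) = -(beta n ^ p * ofXi n v) := by
  have hι (w : (Fin n → ℝ) × (Fin n → ℝ)) :
      CliffordAlgebra.involute (Q := (0 : QuadraticForm ℝ ((Fin n → ℝ) × (Fin n → ℝ))))
        (ExteriorAlgebra.ι ℝ w) = -ExteriorAlgebra.ι ℝ w := CliffordAlgebra.involute_ι w
  have hβ : CliffordAlgebra.involute (Q := (0 : QuadraticForm ℝ ((Fin n → ℝ) × (Fin n → ℝ))))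
      (beta n) = beta n := by
    simp only [beta, dx, dxi, ofX, ofXi, LinearMap.comp_apply, map_sum, map_mul, hι, neg_mul_neg]
  rw [map_mul, map_pow, hβ, ofXi, LinearMap.comp_apply, hι, mul_neg]

variable {E : Type*} [NormedAddCommGroup E] [NormedSpace ℝ E] {k : ℕ∞ω}

theorem contDiff_mul {f g : E → SuperAlg n} (hf : ContDiff ℝ k f) (hg : ContDiff ℝ k g) :
    ContDiff ℝ k fun x => f x * g x := by
  let B : SuperAlg n →L[ℝ] SuperAlg n →L[ℝ] SuperAlg n :=
    (LinearMap.toContinuousLinearMap.toLinearMap ∘ₗ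
      LinearMap.mul ℝ (SuperAlg n)).toContinuousLinearMap
  exact (B.contDiff.comp hf).clm_apply hg

theorem contDiff_prod_ofFn {m : ℕ} {f : Fin m → E → SuperAlg n} (hf : ∀ j, ContDiff ℝ k (f j)) :
    ContDiff ℝ k fun x => (List.ofFn fun j => f j x).prod := by
  induction m with
  | zero => simpa using contDiff_const
  | succ m ih =>
    simpa only [List.ofFn_succ, List.prod_cons] using contDiff_mul (hf 0) (ih fun j => hf j.succ)

theorem contDiff_pow {f : E → SuperAlg n} (hf : ContDiff ℝ k f) (m : ℕ) :
    ContDiff ℝ k fun x => f x ^ m := by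
  simpa only [List.ofFn_const, List.prod_replicate] using contDiff_prod_ofFn fun _ : Fin m => hf

theorem contDiff_wedgeSharp {v : E → Fin n → ℝ} (hv : ContDiff ℝ k v) :
    ContDiff ℝ k fun x => wedgeSharp (v x) :=
  contDiff_mul ((ofX n).toContinuousLinearMap.contDiff.comp hv)
    ((ofXi n).toContinuousLinearMap.contDiff.comp hv)

end SuperAlg

/-! ### Test functions and weak positivity -/

section TestFunctions

variable {E F : Type*} [NormedAddCommGroup E] [NormedSpace ℝ E] {U : Opens E}
  [NormedAddCommGroup F] [NormedSpace ℝ F]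

/-- The product `x ↦ f x • G x` of a scalar test function and a smooth function. -/
noncomputable def smulTestFunction (f : 𝓓(U, ℝ)) (G : E → F) (hG : ContDiff ℝ ∞ G) : 𝓓(U, F) where
  toFun x := f x • G x
  contDiff' := f.contDiff.smul hG
  hasCompactSupport' := f.hasCompactSupport.smul_right
  tsupport_subset' := (tsupport_smul_subset_left f G).trans f.tsupport_subset

@[simp]
theorem smulTestFunction_apply (f : 𝓓(U, ℝ)) (G : E → F) (hG : ContDiff ℝ ∞ G) (x : E) :
    smulTestFunction f G hG x = f x • G x := rfl

theorem testFunction_eq_zero_of_notMem (f : 𝓓(U, F)) {x : E} (hx : x ∉ U) : f x = 0 :=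
  image_eq_zero_of_notMem_tsupport fun h => hx (f.tsupport_subset h)

theorem exists_testFunction_eq_of_eq_zero {F' : Type*} [NormedAddCommGroup F'] [NormedSpace ℝ F']
    (f : 𝓓(U, F)) {G : E → F'} (hG : ContDiff ℝ ∞ G) (h : ∀ x, f x = 0 → G x = 0) :
    ∃ g : 𝓓(U, F'), ∀ x, g x = G x := by
  have hsupp : tsupport G ⊆ tsupport f := closure_mono fun x hx hfx => hx (h x hfx)
  exact ⟨⟨G, hG, f.hasCompactSupport.of_isClosed_subset (isClosed_tsupport _) hsupp,
    hsupp.trans f.tsupport_subset⟩, fun _ => rfl⟩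

theorem exists_testFunction_eq_one_on [FiniteDimensional ℝ E] {K : Set E} (hK : IsCompact K)
    (hKU : K ⊆ U) : ∃ η : 𝓓(U, ℝ), (∀ x, 0 ≤ η x) ∧ ∀ x ∈ K, η x = 1 := by
  obtain ⟨L, hL, hKL, hLU⟩ := exists_compact_between hK U.isOpen hKU
  obtain ⟨f, hf, hrange, hsupp, hone⟩ := exists_contMDiff_support_eq_eq_one_iff
    (modelWithCornersSelf ℝ E) (n := ⊤) isOpen_interior hK.isClosed hKL
  have hfL : tsupport f ⊆ L := by
    rw [tsupport, hsupp]
    exact closure_minimal interior_subset hL.isClosed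
  exact ⟨⟨f, hf.contDiff, hL.of_isClosed_subset (isClosed_tsupport _) hfL, hfL.trans hLU⟩,
    fun x => (hrange (Set.mem_range_self x)).1, fun x hx => (hone x).1 hx⟩

end TestFunctions

section Radial

variable {E : Type*} [NormedAddCommGroup E] [InnerProductSpace ℝ E] [ProperSpace E] {U : Opens E}

/-- The radial test function `x ↦ h (‖x - c‖ ^ 2)`. -/
noncomputable def radialTestFunction (c : E) (h : ℝ → ℝ) (hh : ContDiff ℝ ∞ h) {R : ℝ}
    (hR₀ : 0 ≤ R) (hR : Metric.closedBall c R ⊆ U) (hzero : ∀ t, R ^ 2 ≤ t → h t = 0) :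
    𝓓(U, ℝ) :=
  have hsupp : tsupport (fun x : E => h (‖x - c‖ ^ 2)) ⊆ Metric.closedBall c R :=
    closure_minimal (fun x hx => by
      contrapose! hx
      rw [Metric.mem_closedBall, dist_eq_norm, not_le] at hx
      simpa using hzero _ (pow_le_pow_left₀ hR₀ hx.le 2)) Metric.isClosed_closedBall
  { toFun := fun x => h (‖x - c‖ ^ 2)
    contDiff' := hh.comp ((contDiff_id.sub contDiff_const).norm_sq ℝ)
    hasCompactSupport' := (isCompact_closedBall c R).of_isClosed_subset (isClosed_tsupport _) hsupp
    tsupport_subset' := hsupp.trans hR }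

@[simp]
theorem radialTestFunction_apply (c : E) (h : ℝ → ℝ) (hh : ContDiff ℝ ∞ h) {R : ℝ}
    (hR₀ : 0 ≤ R) (hR : Metric.closedBall c R ⊆ U) (hzero : ∀ t, R ^ 2 ≤ t → h t = 0) (x : E) :
    radialTestFunction c h hh hR₀ hR hzero x = h (‖x - c‖ ^ 2) := rfl

end Radial

namespace Supercurrent

open SuperAlg

variable {n p : ℕ} {U : Opens (EuclideanSpace ℝ (Fin n))} {T : Supercurrent U}

theorem IsPositive.nonneg_of_eq_sum_pow (hT : T.IsPositive (p + 1)) {ι : Type*} [Fintype ι]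
    (α : ι → 𝓓(U, Fin n → ℝ)) (a : TestForm U)
    (ha : ∀ x, a x = (∑ i, wedgeSharp (α i x)) ^ (p + 1)) : 0 ≤ T a := by
  have hexists (σ : Fin (p + 1) → ι) : ∃ P : TestForm U, ∀ x,
      P x = (List.ofFn fun j => wedgeSharp (α (σ j) x)).prod :=
    exists_testFunction_eq_of_eq_zero (α (σ 0))
      (contDiff_prod_ofFn fun j => contDiff_wedgeSharp (α (σ j)).contDiff)
      fun x hx => by simp [List.ofFn_succ, hx, wedgeSharp]
  choose P hP using hexists
  have haP : a = ∑ σ, P σ := by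
    ext x
    simp only [ha, sum_pow_eq_sum_prod_ofFn, sum_apply, hP]
  rw [haP, map_sum]
  refine Finset.sum_nonneg fun σ _ => hT (fun j => α (σ j)) _ fun x => ?_
  simp only [hP, J_ofX, wedgeSharp]

/-- `f` need not be a `2 (p + 1)`-th power of a smooth function, but `f + ε` is. -/
theorem IsPositive.nonneg_of_eq_smul_sum_pow (hT : T.IsPositive (p + 1)) {ι : Type*} [Fintype ι]
    (f : 𝓓(U, ℝ)) (hf : ∀ x, 0 ≤ f x) {α : ι → EuclideanSpace ℝ (Fin n) → Fin n → ℝ}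
    (hα : ∀ i, ContDiff ℝ ∞ (α i)) (a : TestForm U)
    (ha : ∀ x, a x = f x • (∑ i, wedgeSharp (α i x)) ^ (p + 1)) : 0 ≤ T a := by
  obtain ⟨η, -, hη⟩ := exists_testFunction_eq_one_on f.hasCompactSupport f.tsupport_subset
  obtain ⟨b, hb⟩ : ∃ b : TestForm U, ∀ x,
      b x = η x ^ (2 * (p + 1)) • (∑ i, wedgeSharp (α i x)) ^ (p + 1) :=
    exists_testFunction_eq_of_eq_zero η ((η.contDiff.pow _).smul
      (contDiff_pow (ContDiff.sum fun i _ => contDiff_wedgeSharp (hα i)) _))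
      fun x hx => by rw [hx, zero_pow (by positivity), zero_smul]
  have hε : ∀ ε : ℝ, 0 < ε → 0 ≤ T a + ε * T b := fun ε hε => by
    have hpos (x) : 0 < f x + ε := add_pos_of_nonneg_of_pos (hf x) hε
    let w (x : EuclideanSpace ℝ (Fin n)) : ℝ := (f x + ε) ^ (((2 * (p + 1) : ℕ) : ℝ)⁻¹)
    have hw : ContDiff ℝ ∞ w :=
      (f.contDiff.add contDiff_const).rpow_const_of_ne fun x => (hpos x).ne'
    have hw_pow (x) : w x ^ (2 * (p + 1)) = f x + ε :=
      Real.rpow_inv_natCast_pow (hpos x).le (by positivity)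
    have hηw (x) : (η x * w x) ^ (2 * (p + 1)) = f x + ε * η x ^ (2 * (p + 1)) := by
      rw [mul_pow, hw_pow, mul_add, mul_comm ε, add_left_inj]
      by_cases hx : f x = 0
      · rw [hx, mul_zero]
      · rw [hη x (subset_tsupport _ hx), one_pow, one_mul]
    have hab : 0 ≤ T (a + ε • b) := hT.nonneg_of_eq_sum_pow
      (fun i => smulTestFunction η (fun x => w x • α i x) (hw.smul (hα i))) _ fun x => by
        simp only [smulTestFunction_apply, smul_smul, wedgeSharp_smul, ← Finset.smul_sum, smul_pow]
        rw [← pow_mul, hηw, add_apply, smul_apply, ha, hb, smul_smul, ← add_smul]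
    simpa using hab
  have hlim : Filter.Tendsto (fun ε => T a + ε * T b) (nhdsWithin 0 (Set.Ioi 0)) (nhds (T a)) := by
    have : Continuous fun ε : ℝ => T a + ε * T b := by fun_prop
    simpa using (this.tendsto 0).mono_left nhdsWithin_le_nhds
  exact ge_of_tendsto hlim (Filter.eventually_of_mem self_mem_nhdsWithin hε)

theorem IsPositive.nonneg_of_eq_smul_lagrange_pow (hT : T.IsPositive (p + 1)) (f : 𝓓(U, ℝ))
    (hf : ∀ x, 0 ≤ f x) {V : EuclideanSpace ℝ (Fin n) → Fin n → ℝ} (hV : ContDiff ℝ ∞ V)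
    (a : TestForm U)
    (ha : ∀ x, a x = f x • ((∑ i, V x i ^ 2) • beta n - wedgeSharp (V x)) ^ (p + 1)) :
    0 ≤ T a := by
  have hVi (i) : ContDiff ℝ ∞ fun x => V x i := contDiff_pi.1 hV i
  have hscaled : 0 ≤ T ((2 : ℝ) ^ (p + 1) • a) :=
    hT.nonneg_of_eq_smul_sum_pow f hf
      (α := fun (q : Fin n × Fin n) x =>
        V x q.1 • Pi.single q.2 (1 : ℝ) - V x q.2 • Pi.single q.1 1)
      (fun q => ((hVi q.1).smul contDiff_const).sub ((hVi q.2).smul contDiff_const)) _ fun x => by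
        rw [sum_wedgeSharp_lagrange, smul_pow, smul_apply, ha, smul_comm]
  rw [map_smul, smul_eq_mul] at hscaled
  exact nonneg_of_mul_nonneg_right hscaled (by positivity)

end Supercurrent

/-! ### The mass measure -/

section MassMeasure

open scoped CompactlySupported

theorem exists_positiveLinearMap_extension {V W : Type*} [AddCommGroup V] [Module ℝ V]
    [AddCommGroup W] [PartialOrder W] [IsOrderedAddMonoid W] [Module ℝ W] [PosSMulMono ℝ W]
    (i : V →ₗ[ℝ] W) (hmajor : ∀ w, ∃ v, w ≤ i v) (Λ : V →ₗ[ℝ] ℝ) (hΛ : ∀ v, 0 ≤ i v → 0 ≤ Λ v) :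
    ∃ G : W →ₚ[ℝ] ℝ, ∀ v, G (i v) = Λ v := by
  have hker : Λ ∈ (LinearMap.ker i).dualAnnihilator := by
    refine (Submodule.mem_dualAnnihilator Λ).2 fun v (hv : i v = 0) => le_antisymm ?_ (hΛ v hv.ge)
    simpa using hΛ (-v) (by simp [hv])
  obtain ⟨g, rfl⟩ : ∃ g, i.dualMap g = Λ := by
    rwa [← LinearMap.range_dualMap_eq_dualAnnihilator_ker] at hker
  obtain ⟨G, hGg, hG⟩ := riesz_extension (PointedCone.positive ℝ W)
    (g.toPMap (LinearMap.range i)) (by rintro ⟨_, v, rfl⟩ hv; exact hΛ v hv) fun w => by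
      obtain ⟨v, hv⟩ := hmajor (-w)
      exact ⟨⟨i v, v, rfl⟩, neg_le_iff_add_nonneg.1 hv⟩
  exact ⟨PositiveLinearMap.mk₀ G hG, fun v => hGg ⟨i v, v, rfl⟩⟩

theorem isCompact_preimage_subtypeVal {X : Type*} [TopologicalSpace X] {U : Opens X} {K : Set X}
    (hK : IsCompact K) (hKU : K ⊆ U) :
    IsCompact (Subtype.val ⁻¹' K : Set U) :=
  (Topology.IsInducing.subtypeVal.isCompact_preimage_iff (by simpa using hKU)).2 hK

variable {E : Type*} [NormedAddCommGroup E] [NormedSpace ℝ E] {U : Opens E}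

/-- Test functions on `U` as compactly supported continuous functions on the subtype `U`. -/
noncomputable def testFunctionRestrict (U : Opens E) : 𝓓(U, ℝ) →ₗ[ℝ] C_c(U, ℝ) where
  toFun f :=
    { toFun := fun x => f x
      continuous_toFun := f.continuous.comp continuous_subtype_val
      hasCompactSupport' := HasCompactSupport.intro
        (isCompact_preimage_subtypeVal f.hasCompactSupport f.tsupport_subset)
        fun _ hx => image_eq_zero_of_notMem_tsupport hx }
  map_add' _ _ := rfl
  map_smul' _ _ := rfl

theorem exists_le_testFunctionRestrict [FiniteDimensional ℝ E] (g : C_c(U, ℝ)) :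
    ∃ f, g ≤ testFunctionRestrict U f := by
  obtain ⟨η, hη₀, hη₁⟩ := exists_testFunction_eq_one_on (U := U)
    (g.hasCompactSupport.image continuous_subtype_val) (by rintro _ ⟨x, -, rfl⟩; exact x.2)
  obtain ⟨C, hC⟩ := g.continuous.bounded_above_of_compact_support g.hasCompactSupport
  refine ⟨C • η, fun x => ?_⟩
  change g x ≤ C * η x
  by_cases hx : g x = 0
  · rw [hx]
    exact mul_nonneg ((norm_nonneg _).trans (hC x)) (hη₀ x)
  · rw [hη₁ x ⟨x, subset_tsupport _ hx, rfl⟩, mul_one]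
    exact (le_abs_self _).trans (hC x)

theorem exists_measure_integral_eq_of_nonneg [FiniteDimensional ℝ E] [MeasurableSpace E]
    [BorelSpace E] (Λ : 𝓓(U, ℝ) →ₗ[ℝ] ℝ) (hΛ : ∀ f : 𝓓(U, ℝ), (∀ x, 0 ≤ f x) → 0 ≤ Λ f) :
    ∃ μ : Measure E, (∀ K, IsCompact K → K ⊆ U → μ K < ⊤) ∧ ∀ f : 𝓓(U, ℝ), Λ f = ∫ x, f x ∂μ := by
  have : LocallyCompactSpace U := U.isOpen.locallyCompactSpace
  have : PosSMulMono ℝ C_c(U, ℝ) := ⟨fun r hr g h hgh x => mul_le_mul_of_nonneg_left (hgh x) hr⟩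
  obtain ⟨G, hG⟩ := exists_positiveLinearMap_extension (testFunctionRestrict U)
    exists_le_testFunctionRestrict Λ fun f hf => hΛ f fun x => by
      by_cases hx : x ∈ U
      · exact hf ⟨x, hx⟩
      · exact (testFunction_eq_zero_of_notMem f hx).ge
  have hval : MeasurableEmbedding (Subtype.val : U → E) :=
    MeasurableEmbedding.subtype_coe U.isOpen.measurableSet
  refine ⟨(RealRMK.rieszMeasure G).map Subtype.val, fun K hK hKU => ?_, fun f => ?_⟩
  · rw [hval.map_apply]
    exact (isCompact_preimage_subtypeVal hK hKU).measure_lt_top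
  · rw [hval.integral_map, ← hG f]
    exact (RealRMK.integral_rieszMeasure G (testFunctionRestrict U f)).symm

theorem integrable_testFunction [MeasurableSpace E] [BorelSpace E] {μ : Measure E}
    (hμ : ∀ K, IsCompact K → K ⊆ U → μ K < ⊤) (f : 𝓓(U, ℝ)) : Integrable f μ := by
  rw [← integrableOn_iff_integrable_of_support_subset (subset_tsupport f)]
  obtain ⟨C, hC⟩ := f.continuous.bounded_above_of_compact_support f.hasCompactSupport
  exact IntegrableOn.of_bound (hμ _ f.hasCompactSupport f.tsupport_subset)
    f.aestronglyMeasurable C (Filter.Eventually.of_forall hC)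

end MassMeasure

namespace Supercurrent

open SuperAlg

variable {n m p : ℕ} {U : Opens (EuclideanSpace ℝ (Fin n))} {T : Supercurrent U}

theorem wedge_ofFun (T : Supercurrent U) (b : SuperAlg n) (f : 𝓓(U, ℝ)) :
    T.wedge b (TestForm.ofFun f) = T (smulTestFunction f (fun _ => b) contDiff_const) := by
  refine congrArg T (TestFunction.ext fun x => ?_)
  change b * algebraMap ℝ (SuperAlg n) (f x) = f x • b
  rw [← Algebra.commutes, ← Algebra.smul_def]

theorem IsPositive.exists_isMassMeasure (hT : T.IsPositive (p + 1)) :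
    ∃ μ, T.IsMassMeasure (p + 1) μ := by
  refine exists_measure_integral_eq_of_nonneg
    ((T.wedge (((p + 1)! : ℝ)⁻¹ • beta n ^ (p + 1))).comp TestForm.ofFun).toLinearMap fun f hf => ?_
  refine (wedge_ofFun T _ f).ge.trans' (hT.nonneg_of_eq_smul_sum_pow (((p + 1)! : ℝ)⁻¹ • f)
    (fun x => mul_nonneg (by positivity) (hf x)) (α := fun i _ => Pi.single i 1)
    (fun _ => contDiff_const) _ fun x => ?_)
  rw [smulTestFunction_apply, ← beta_eq_sum_wedgeSharp, smul_apply, smul_comm, smul_assoc]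

theorem IsMassMeasure.apply_eq_integral {μ : Measure (EuclideanSpace ℝ (Fin n))}
    (hμ : T.IsMassMeasure m μ) (f : 𝓓(U, ℝ)) :
    T (smulTestFunction f (fun _ => beta n ^ m) contDiff_const) = (m ! : ℝ) * ∫ x, f x ∂μ := by
  rw [← hμ.2 f, wedge_ofFun, ← smul_eq_mul, ← map_smul]
  refine congrArg T (TestFunction.ext fun x => ?_)
  simp only [smul_apply, smulTestFunction_apply]
  rw [smul_comm (f x), smul_inv_smul₀ (by positivity)]

end Supercurrent

/-! ### The first variation along radial fields -/

theorem lineDeriv_continuousLinearMap_comp {E F G : Type*} [NormedAddCommGroup E] [NormedSpace ℝ E]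
    [NormedAddCommGroup F] [NormedSpace ℝ F] [NormedAddCommGroup G] [NormedSpace ℝ G]
    (L : F →L[ℝ] G) {f : E → F} {x v : E} (hf : LineDifferentiableAt ℝ f x v) :
    lineDeriv ℝ (fun y => L (f y)) x v = L (lineDeriv ℝ f x v) :=
  (L.hasFDerivAt.comp_hasDerivAt (0 : ℝ) hf.hasLineDerivAt).deriv

namespace TestForm

open SuperAlg

variable {n : ℕ} {U : Opens (EuclideanSpace ℝ (Fin n))}

theorem d_apply (a : TestForm U) (x : EuclideanSpace ℝ (Fin n)) :
    d a x = ∑ k, dx k * lineDeriv ℝ a x (EuclideanSpace.single k 1) := by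
  simp only [d, sum_apply]
  refine Finset.sum_congr rfl fun k _ => ?_
  change dx k * (TestFunction.lineDerivCLM ℝ (EuclideanSpace.single k (1 : ℝ)) a : TestForm U) x = _
  rw [TestFunction.lineDerivCLM_apply_of_le le_top]

theorem d_constWedge {b : SuperAlg n} (hb : ∀ z, Commute b z) (a : TestForm U) :
    d (constWedge b a) = constWedge b (d a) := by
  ext x
  have hderiv (v) : lineDeriv ℝ (constWedge b a) x v = b * lineDeriv ℝ a x v :=
    lineDeriv_continuousLinearMap_comp (clm (LinearMap.mulLeft ℝ b))
      (a.contDiff.differentiable (by simp) x).lineDifferentiableAt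
  change _ = b * d a x
  simp only [d_apply, hderiv, Finset.mul_sum, ← mul_assoc, (hb (dx _)).eq]

/-- The `(0,1)`-form `∑ k, X k dξ_k` with the coefficients of a vector field `X`; testing a
supercurrent on it is the first variation in the direction `X`. -/
noncomputable def ofXiField : 𝓓(U, Fin n → ℝ) →L[ℝ] TestForm U :=
  TestFunction.postcompCLM (ofXi n).toContinuousLinearMap

theorem sign_constWedge_beta_pow_ofXiField (p : ℕ) (X : 𝓓(U, Fin n → ℝ)) :
    sign (constWedge (beta n ^ p) (ofXiField X)) = -constWedge (beta n ^ p) (ofXiField X) :=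
  TestFunction.ext fun x => involute_beta_pow_mul_ofXi p (X x)

theorem d_ofXiField_apply {X : 𝓓(U, Fin n → ℝ)} {x : EuclideanSpace ℝ (Fin n)}
    {u ψ : ℝ} {v : Fin n → ℝ}
    (hX : ∀ k, lineDeriv ℝ X x (EuclideanSpace.single k 1) = u • Pi.single k 1 + (ψ * v k) • v) :
    d (ofXiField X) x = u • beta n + ψ • wedgeSharp v := by
  have hderiv (w) : lineDeriv ℝ (ofXiField X) x w = ofXi n (lineDeriv ℝ X x w) :=
    lineDeriv_continuousLinearMap_comp (ofXi n).toContinuousLinearMap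
      (X.contDiff.differentiable (by simp) x).lineDifferentiableAt
  simp only [d_apply, hderiv, hX, map_add, map_smul, mul_add, mul_smul_comm,
    Finset.sum_add_distrib, ← Finset.smul_sum, mul_smul]
  rw [wedgeSharp, ofX_eq_sum, Finset.sum_mul]
  simp only [smul_mul_assoc, dxi, beta]

end TestForm

namespace Supercurrent

open SuperAlg

variable {n p : ℕ} {U : Opens (EuclideanSpace ℝ (Fin n))} {T : Supercurrent U}

theorem apply_constWedge_d_ofXiField_eq_zero (hT : T.d.wedge (beta n ^ p) = 0)
    (X : 𝓓(U, Fin n → ℝ)) :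
    T (TestForm.constWedge (beta n ^ p) (TestForm.d (TestForm.ofXiField X))) = 0 := by
  have hX : T (TestForm.d (TestForm.sign (TestForm.constWedge (beta n ^ p)
      (TestForm.ofXiField X)))) = 0 := DFunLike.congr_fun hT (TestForm.ofXiField X)
  rwa [TestForm.sign_constWedge_beta_pow_ofXiField, map_neg, map_neg, neg_eq_zero,
    TestForm.d_constWedge fun z => (commute_beta z).pow_left p] at hX

theorem apply_eq_zero_of_radial_field (hT : T.d.wedge (beta n ^ p) = 0)
    {c : EuclideanSpace ℝ (Fin n)} {u ψ : 𝓓(U, ℝ)}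
    (hu : ∀ x, HasFDerivAt u (ψ x • innerSL ℝ (x - c)) x) (a : TestForm U)
    (ha : ∀ x, a x = u x • beta n ^ (p + 1) +
      ψ x • (beta n ^ p * wedgeSharp (x - c).ofLp)) : T a = 0 := by
  let V (x : EuclideanSpace ℝ (Fin n)) : Fin n → ℝ := (x - c).ofLp
  have hV (x) : HasFDerivAt V (EuclideanSpace.equiv (Fin n) ℝ : _ →L[ℝ] Fin n → ℝ) x :=
    (EuclideanSpace.equiv (Fin n) ℝ).hasFDerivAt.comp x ((hasFDerivAt_id x).sub_const c)
  let X : 𝓓(U, Fin n → ℝ) := smulTestFunction u V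
    ((EuclideanSpace.equiv (Fin n) ℝ).contDiff.comp (contDiff_id.sub contDiff_const))
  have hX (x k) : lineDeriv ℝ X x (EuclideanSpace.single k 1) =
      u x • Pi.single k 1 + (ψ x * V x k) • V x := by
    have hsingle : EuclideanSpace.equiv (Fin n) ℝ (EuclideanSpace.single k 1) = Pi.single k 1 := rfl
    refine (((hu x).smul (hV x)).hasLineDerivAt _).lineDeriv.trans ?_
    simp [V, EuclideanSpace.inner_single_right, hsingle]
  rw [← apply_constWedge_d_ofXiField_eq_zero hT X]
  refine congrArg T (TestFunction.ext fun x => ?_)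
  change a x = beta n ^ p * TestForm.d (TestForm.ofXiField X) x
  rw [ha, TestForm.d_ofXiField_apply (hX x), mul_add, mul_smul_comm, mul_smul_comm, ← pow_succ]

theorem apply_eq_two_mul_of_radial (hT : T.d.wedge (beta n ^ p) = 0) {c : EuclideanSpace ℝ (Fin n)}
    {h ψ : ℝ → ℝ} (hh : ∀ t, HasDerivAt h (-ψ t) t) {u w : 𝓓(U, ℝ)}
    (hu : ∀ x, u x = h (‖x - c‖ ^ 2)) (hw : ∀ x, w x = ψ (‖x - c‖ ^ 2)) (a b : TestForm U)
    (ha : ∀ x, a x = w x • (beta n ^ p * wedgeSharp (x - c).ofLp))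
    (hb : ∀ x, b x = u x • beta n ^ (p + 1)) : T b = 2 * T a := by
  have hderiv (x) : HasFDerivAt u (((-2 : ℝ) • w) x • innerSL ℝ (x - c)) x := by
    have hN : HasFDerivAt (fun x => ‖x - c‖ ^ 2) (2 • innerSL ℝ (x - c)) x := by
      simpa using ((hasFDerivAt_id x).sub_const c).norm_sq
    rw [show (u : EuclideanSpace ℝ (Fin n) → ℝ) = h ∘ fun x => ‖x - c‖ ^ 2 from funext hu]
    refine ((hh (‖x - c‖ ^ 2)).comp_hasFDerivAt x hN).congr_fderiv ?_
    rw [smul_apply, hw, ← Nat.cast_smul_eq_nsmul ℝ, smul_smul, smul_eq_mul, Nat.cast_ofNat,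
      neg_mul_comm, mul_comm]
  have hzero : T (b - (2 : ℝ) • a) = 0 := apply_eq_zero_of_radial_field hT hderiv _ fun x => by
    simp only [sub_apply, smul_apply, smul_eq_mul, ha, hb]
    module
  rwa [map_sub, map_smul, smul_eq_mul, sub_eq_zero] at hzero

/-- The factor `|α|^(2p)` comes from the `(p + 1)`-th power of the form `|α|² β - α ∧ α^#`. -/
theorem IsPositive.apply_beta_pow_mul_wedgeSharp_le (hT : T.IsPositive (p + 1)) (f : 𝓓(U, ℝ))
    (hf : ∀ x, 0 ≤ f x) {V : EuclideanSpace ℝ (Fin n) → Fin n → ℝ} (hV : ContDiff ℝ ∞ V)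
    (a b : TestForm U)
    (ha : ∀ x, a x = (f x * (∑ i, V x i ^ 2) ^ p) • (beta n ^ p * wedgeSharp (V x)))
    (hb : ∀ x, b x = (f x * (∑ i, V x i ^ 2) ^ (p + 1)) • beta n ^ (p + 1)) :
    (p + 1) * T a ≤ T b := by
  have hba : 0 ≤ T (b - ((p : ℝ) + 1) • a) :=
    hT.nonneg_of_eq_smul_lagrange_pow f hf hV _ fun x => by
      rw [smul_beta_sub_wedgeSharp_pow_succ, sub_apply, smul_apply, ha, hb]
      module
  simpa using hba

theorem IsMassMeasure.radial_inequality {μ : Measure (EuclideanSpace ℝ (Fin n))}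
    (hμ : T.IsMassMeasure (p + 1) μ) (hpos : T.IsPositive (p + 1))
    (hclosed : T.d.wedge (beta n ^ p) = 0) {c : EuclideanSpace ℝ (Fin n)} {R : ℝ} (hR₀ : 0 ≤ R)
    (hR : Metric.closedBall c R ⊆ U) {g h : ℝ → ℝ} (hg : ContDiff ℝ ∞ g)
    (hg_nonneg : ∀ t, 0 ≤ t → 0 ≤ g t) (hg_zero : ∀ t, R ^ 2 ≤ t → g t = 0)
    (hh : ∀ t, HasDerivAt h (-(t ^ p * g t)) t) (hh_zero : ∀ t, R ^ 2 ≤ t → h t = 0) :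
    (p + 1) * ∫ x, h (‖x - c‖ ^ 2) ∂μ ≤
      2 * ∫ x, g (‖x - c‖ ^ 2) * (‖x - c‖ ^ 2) ^ (p + 1) ∂μ := by
  have hgp (q : ℕ) : ContDiff ℝ ∞ fun t => g t * t ^ q := hg.mul (contDiff_id.pow q)
  have hh_smooth : ContDiff ℝ ∞ h := by
    refine contDiff_infty_iff_deriv.2 ⟨fun t => (hh t).differentiableAt, ?_⟩
    simpa only [funext fun t => (hh t).deriv, mul_comm] using (hgp p).neg
  let w (q : ℕ) : 𝓓(U, ℝ) := radialTestFunction c _ (hgp q) hR₀ hR fun t ht => by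
    rw [hg_zero t ht, zero_mul]
  let u : 𝓓(U, ℝ) := radialTestFunction c h hh_smooth hR₀ hR hh_zero
  let V (x : EuclideanSpace ℝ (Fin n)) : Fin n → ℝ := (x - c).ofLp
  have hV : ContDiff ℝ ∞ V :=
    (EuclideanSpace.equiv (Fin n) ℝ).contDiff.comp (contDiff_id.sub contDiff_const)
  have hVN (x) : ∑ i, V x i ^ 2 = ‖x - c‖ ^ 2 := (EuclideanSpace.real_norm_sq_eq (x - c)).symm
  let a : TestForm U := smulTestFunction (w p) (fun x => beta n ^ p * wedgeSharp (V x))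
    (contDiff_mul contDiff_const (contDiff_wedgeSharp hV))
  let b (f : 𝓓(U, ℝ)) : TestForm U := smulTestFunction f (fun _ => beta n ^ (p + 1)) contDiff_const
  have hcompare : (p + 1) * T a ≤ T (b (w (p + 1))) :=
    hpos.apply_beta_pow_mul_wedgeSharp_le (w 0)
      (fun x => by simpa [w] using hg_nonneg _ (sq_nonneg _)) hV a _
      (fun x => by simp [a, w, hVN]) (fun x => by simp [b, w, hVN])
  have hvariation : T (b u) = 2 * T a :=
    apply_eq_two_mul_of_radial hclosed (ψ := fun t => g t * t ^ p)
      (fun t => by simpa only [mul_comm] using hh t) (fun _ => rfl) (fun _ => rfl)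
      a (b u) (fun _ => rfl) fun _ => rfl
  rw [hμ.apply_eq_integral] at hcompare hvariation
  have hfac : (0 : ℝ) < ((p + 1)! : ℝ) := by positivity
  refine le_of_mul_le_mul_left ?_ hfac
  calc ((p + 1)! : ℝ) * ((p + 1) * ∫ x, u x ∂μ) = 2 * ((p + 1) * T a) := by
        linear_combination (p + 1 : ℝ) * hvariation
    _ ≤ 2 * (((p + 1)! : ℝ) * ∫ x, w (p + 1) x ∂μ) := by gcongr
    _ = _ := by
      simp only [w, radialTestFunction_apply]
      ring

end Supercurrent

/-! ### Truncated powers -/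

/-- A smooth cutoff with values in `[0, 1]` which vanishes up to `a₀`, increases to the value `1` on
`[a, b₀]` and vanishes again from `b` on. -/
structure IsPlateau (a₀ a b₀ b : ℝ) (θ : ℝ → ℝ) : Prop where
  contDiff : ContDiff ℝ ∞ θ
  nonneg : ∀ t, 0 ≤ θ t
  le_one : ∀ t, θ t ≤ 1
  eq_zero_of_le : ∀ t ≤ a₀, θ t = 0
  monotoneOn : MonotoneOn θ (Set.Iic b₀)
  eq_one : ∀ t ∈ Set.Icc a b₀, θ t = 1
  eq_zero_of_ge : ∀ t, b ≤ t → θ t = 0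

theorem exists_isPlateau {a₀ a b₀ b : ℝ} (ha : a₀ < a) (hb : b₀ < b) :
    ∃ θ, IsPlateau a₀ a b₀ b θ := by
  let up (t : ℝ) : ℝ := Real.smoothTransition ((t - a₀) / (a - a₀))
  let down (t : ℝ) : ℝ := Real.smoothTransition ((b - t) / (b - b₀))
  have hdown (t) (ht : t ≤ b₀) : down t = 1 :=
    Real.smoothTransition.one_of_one_le ((one_le_div (sub_pos.2 hb)).2 (by linarith))
  refine ⟨fun t => up t * down t, ?_, fun t => ?_, fun t => ?_, fun t ht => ?_, ?_,
    fun t ht => ?_, fun t ht => ?_⟩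
  · exact (Real.smoothTransition.contDiff.comp ((contDiff_id.sub contDiff_const).div_const _)).mul
      (Real.smoothTransition.contDiff.comp ((contDiff_const.sub contDiff_id).div_const _))
  · exact mul_nonneg (Real.smoothTransition.nonneg _) (Real.smoothTransition.nonneg _)
  · exact mul_le_one₀ (Real.smoothTransition.le_one _) (Real.smoothTransition.nonneg _)
      (Real.smoothTransition.le_one _)
  · exact mul_eq_zero_of_left (Real.smoothTransition.zero_of_nonpos
      (div_nonpos_of_nonpos_of_nonneg (by linarith) (by linarith))) _
  · intro t ht u hu htu
    simp only [hdown t ht, hdown u hu, mul_one]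
    exact Real.smoothTransition.monotone (by have := sub_pos.2 ha; gcongr)
  · simp only [hdown t ht.2, mul_one]
    exact Real.smoothTransition.one_of_one_le
      ((one_le_div (sub_pos.2 ha)).2 (by linarith [ht.1]))
  · exact mul_eq_zero_of_right _ (Real.smoothTransition.zero_of_nonpos
      (div_nonpos_of_nonpos_of_nonneg (by linarith) (by linarith)))

/-- The solution of `h' = -k θ t ^ (-k - 1)` with `h b = 0`. For a plateau `θ` it is a smoothing of
`((max t a) ^ (-k) - b ^ (-k))⁺`. -/
noncomputable def truncatedPower (k b : ℝ) (θ : ℝ → ℝ) (t : ℝ) : ℝ :=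
  ∫ τ in t..b, k * (θ τ * τ ^ (-k - 1))

namespace IsPlateau

variable {a₀ a b₀ b k t : ℝ} {θ : ℝ → ℝ}

theorem contDiff_mul_rpow (hθ : IsPlateau a₀ a b₀ b θ) (ha₀ : 0 < a₀) (e : ℝ) :
    ContDiff ℝ ∞ fun t => θ t * t ^ e := by
  refine contDiff_iff_contDiffAt.2 fun t => ?_
  rcases lt_or_ge t a₀ with ht | ht
  · refine (contDiffAt_const (c := (0 : ℝ))).congr_of_eventuallyEq
      (Filter.eventually_of_mem (Iio_mem_nhds ht) fun u hu => ?_)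
    simp [hθ.eq_zero_of_le u (le_of_lt hu)]
  · exact hθ.contDiff.contDiffAt.mul
      (contDiffAt_id.rpow_const_of_ne (ha₀.trans_le ht).ne')

theorem mul_rpow_mul_pow (hθ : IsPlateau a₀ a b₀ b θ) (ha₀ : 0 < a₀) (e : ℝ) (q : ℕ) (t : ℝ) :
    θ t * t ^ e * t ^ q = θ t * t ^ (e + q) := by
  rcases le_or_gt t a₀ with ht | ht
  · simp only [hθ.eq_zero_of_le t ht, zero_mul]
  · rw [mul_assoc, Real.rpow_add_natCast (ha₀.trans ht).ne']

theorem mul_rpow_nonneg (hθ : IsPlateau a₀ a b₀ b θ) (ha₀ : 0 < a₀) (e t : ℝ) :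
    0 ≤ θ t * t ^ e := by
  rcases le_or_gt t a₀ with ht | ht
  · rw [hθ.eq_zero_of_le t ht, zero_mul]
  · exact mul_nonneg (hθ.nonneg t) (Real.rpow_nonneg (ha₀.trans ht).le e)

theorem hasDerivAt_truncatedPower (hθ : IsPlateau a₀ a b₀ b θ) (ha₀ : 0 < a₀) (k t : ℝ) :
    HasDerivAt (truncatedPower k b θ) (-(k * (θ t * t ^ (-k - 1)))) t := by
  have hcont : Continuous fun τ => k * (θ τ * τ ^ (-k - 1)) :=
    continuous_const.mul (hθ.contDiff_mul_rpow ha₀ _).continuous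
  exact intervalIntegral.integral_hasDerivAt_left (hcont.intervalIntegrable _ _)
    hcont.stronglyMeasurable.stronglyMeasurableAtFilter hcont.continuousAt

theorem contDiff_truncatedPower (hθ : IsPlateau a₀ a b₀ b θ) (ha₀ : 0 < a₀) (k : ℝ) :
    ContDiff ℝ ∞ (truncatedPower k b θ) := by
  refine contDiff_infty_iff_deriv.2
    ⟨fun t => (hθ.hasDerivAt_truncatedPower ha₀ k t).differentiableAt, ?_⟩
  rw [funext fun t => (hθ.hasDerivAt_truncatedPower ha₀ k t).deriv]
  exact (contDiff_const.mul (hθ.contDiff_mul_rpow ha₀ _)).neg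

theorem truncatedPower_eq_zero (hθ : IsPlateau a₀ a b₀ b θ) (ht : b ≤ t) :
    truncatedPower k b θ t = 0 := by
  refine (intervalIntegral.integral_congr fun τ hτ => ?_).trans intervalIntegral.integral_zero
  rw [Set.uIcc_of_ge ht] at hτ
  simp only [hθ.eq_zero_of_ge τ hτ.1, zero_mul, mul_zero]

theorem antitone_truncatedPower (hθ : IsPlateau a₀ a b₀ b θ) (ha₀ : 0 < a₀) (hk : 0 ≤ k) :
    Antitone (truncatedPower k b θ) :=
  antitone_of_hasDerivAt_nonpos (hθ.hasDerivAt_truncatedPower ha₀ k)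
    fun t => neg_nonpos.2 (mul_nonneg hk (hθ.mul_rpow_nonneg ha₀ _ t))

theorem truncatedPower_nonneg (hθ : IsPlateau a₀ a b₀ b θ) (ha₀ : 0 < a₀) (hk : 0 ≤ k) (t : ℝ) :
    0 ≤ truncatedPower k b θ t :=
  (hθ.truncatedPower_eq_zero (le_max_right t b)).ge.trans
    (hθ.antitone_truncatedPower ha₀ hk (le_max_left t b))

theorem mul_sub_le_truncatedPower (hθ : IsPlateau a₀ a b₀ b θ) (ha₀ : 0 < a₀) (hk : 0 ≤ k)
    {u C : ℝ} (ht : 0 < t) (htu : t ≤ u) (hC : ∀ τ ∈ Set.Icc t u, C ≤ θ τ) :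
    C * (t ^ (-k) - u ^ (-k)) ≤ truncatedPower k b θ t := by
  have hanti : AntitoneOn (fun τ => truncatedPower k b θ τ - C * τ ^ (-k)) (Set.Icc t u) := by
    have hderiv (τ) (hτ : 0 < τ) : HasDerivAt (fun τ => truncatedPower k b θ τ - C * τ ^ (-k))
        (-(k * (θ τ * τ ^ (-k - 1))) - C * (-k * τ ^ (-k - 1))) τ :=
      (hθ.hasDerivAt_truncatedPower ha₀ k τ).sub
        ((Real.hasDerivAt_rpow_const (.inl hτ.ne')).const_mul C)
    refine antitoneOn_of_hasDerivWithinAt_nonpos (convex_Icc t u)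
      (fun τ hτ => (hderiv τ (ht.trans_le hτ.1)).continuousAt.continuousWithinAt)
      (fun τ hτ => (hderiv τ (ht.trans_le (interior_subset hτ).1)).hasDerivWithinAt)
      fun τ hτ => ?_
    have hτ' := interior_subset hτ
    have : 0 ≤ (θ τ - C) * (k * τ ^ (-k - 1)) :=
      mul_nonneg (sub_nonneg.2 (hC τ hτ'))
        (mul_nonneg hk (Real.rpow_nonneg (ht.trans_le hτ'.1).le _))
    linarith
  have hle : truncatedPower k b θ u - C * u ^ (-k) ≤ truncatedPower k b θ t - C * t ^ (-k) :=
    hanti (Set.left_mem_Icc.2 htu) (Set.right_mem_Icc.2 htu) htu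
  have hnonneg := hθ.truncatedPower_nonneg ha₀ hk u
  linarith

theorem sub_le_truncatedPower_sub_of_le (hθ : IsPlateau a₀ a b₀ b θ) (ha₀ : 0 < a₀) (hk : 0 ≤ k)
    (ha : a₀ < a) (hab : a ≤ b₀) (ht : t ≤ a₀) :
    a ^ (-k) - b₀ ^ (-k) ≤ truncatedPower k b θ t - θ t * t ^ (-k) := by
  rw [hθ.eq_zero_of_le t ht, zero_mul, sub_zero, ← one_mul (_ - _)]
  exact (hθ.mul_sub_le_truncatedPower ha₀ hk (ha₀.trans ha) hab
    fun τ hτ => (hθ.eq_one τ hτ).ge).trans (hθ.antitone_truncatedPower ha₀ hk (ht.trans ha.le))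

theorem neg_le_truncatedPower_sub (hθ : IsPlateau a₀ a b₀ b θ) (ha₀ : 0 < a₀) (hk : 0 ≤ k)
    (hb₀ : 0 < b₀) (t : ℝ) : -b₀ ^ (-k) ≤ truncatedPower k b θ t - θ t * t ^ (-k) := by
  have hb₀k : 0 ≤ b₀ ^ (-k) := Real.rpow_nonneg hb₀.le _
  have hnonneg := hθ.truncatedPower_nonneg ha₀ hk t
  rcases le_or_gt t a₀ with hta | hat
  · rw [hθ.eq_zero_of_le t hta]
    linarith
  rcases le_total t b₀ with htb | hbt
  · have hle := hθ.mul_sub_le_truncatedPower ha₀ hk (ha₀.trans hat) htb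
      fun τ hτ => hθ.monotoneOn htb hτ.2 hτ.1
    have := mul_le_of_le_one_left hb₀k (hθ.le_one t)
    linarith
  · have hpow : t ^ (-k) ≤ b₀ ^ (-k) :=
      Real.rpow_le_rpow_of_nonpos hb₀ hbt (neg_nonpos.2 hk)
    have hmul : θ t * t ^ (-k) ≤ t ^ (-k) :=
      mul_le_of_le_one_left (Real.rpow_nonneg (hb₀.le.trans hbt) _) (hθ.le_one t)
    linarith

end IsPlateau

/-! ### Comparison of balls -/

theorem measure_ball_le_of_forall_closedBall_le {X : Type*} [PseudoMetricSpace X]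
    [MeasurableSpace X] {μ : Measure X} {c : X} {s : ℝ} {C : ENNReal} (hs : 0 < s)
    (h : ∀ t, 0 < t → t < s → μ (Metric.closedBall c t) ≤ C) : μ (Metric.ball c s) ≤ C := by
  obtain ⟨u, hu_mono, hu_mem, hu_lim⟩ := exists_seq_strictMono_tendsto' hs
  have hball : Metric.ball c s = ⋃ k, Metric.closedBall c (u k) := by
    refine Set.Subset.antisymm (fun x hx => ?_)
      (Set.iUnion_subset fun k => Metric.closedBall_subset_ball (hu_mem k).2)
    obtain ⟨k, hk⟩ := (hu_lim.eventually_const_lt (Metric.mem_ball.1 hx)).exists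
    exact Set.mem_iUnion.2 ⟨k, hk.le⟩
  have hmono : Monotone fun k => Metric.closedBall c (u k) := fun _ _ hjk =>
    Metric.closedBall_subset_closedBall (hu_mono.monotone hjk)
  rw [hball, hmono.measure_iUnion]
  exact iSup_le fun k => h _ (hu_mem k).1 (hu_mem k).2

theorem sq_rpow_neg_half {s : ℝ} (hs : 0 ≤ s) (m : ℕ) :
    (s ^ 2) ^ (-((m : ℝ) / 2)) = (s ^ m)⁻¹ := by
  rw [Real.rpow_neg (sq_nonneg s), ← Real.rpow_natCast s 2, ← Real.rpow_mul hs, Nat.cast_ofNat,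
    mul_div_cancel₀ _ two_ne_zero, Real.rpow_natCast]

theorem IsPlateau.indicator_sub_indicator_le {E : Type*} [SeminormedAddCommGroup E]
    {s₀ s r₀ r : ℝ} {θ : ℝ → ℝ} (hθ : IsPlateau (s₀ ^ 2) (s ^ 2) (r₀ ^ 2) (r ^ 2) θ)
    (hs₀ : 0 < s₀) (hs : s₀ < s) (hsr : s ≤ r₀) (hr : r₀ < r) (m : ℕ) (c x : E) :
    (Metric.closedBall c s₀).indicator (fun _ => (s ^ m)⁻¹) x -
      (Metric.ball c r).indicator (fun _ => (r₀ ^ m)⁻¹) x ≤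
    truncatedPower (m / 2) (r ^ 2) θ (‖x - c‖ ^ 2) -
      θ (‖x - c‖ ^ 2) * (‖x - c‖ ^ 2) ^ (-(m / 2 : ℝ)) := by
  have hs' : 0 < s := hs₀.trans hs
  have hr₀ : 0 < r₀ := hs'.trans_le hsr
  have hk : (0 : ℝ) ≤ m / 2 := by positivity
  rw [← sq_rpow_neg_half hs'.le, ← sq_rpow_neg_half hr₀.le]
  by_cases hxr : x ∈ Metric.ball c r
  · by_cases hxs : x ∈ Metric.closedBall c s₀
    · rw [Set.indicator_of_mem hxs, Set.indicator_of_mem hxr]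
      refine hθ.sub_le_truncatedPower_sub_of_le (by positivity) hk (by gcongr)
        (pow_le_pow_left₀ hs'.le hsr 2) ?_
      exact pow_le_pow_left₀ (norm_nonneg _) (mem_closedBall_iff_norm.1 hxs) 2
    · rw [Set.indicator_of_notMem hxs, Set.indicator_of_mem hxr, zero_sub]
      exact hθ.neg_le_truncatedPower_sub (by positivity) hk (by positivity) _
  · have hxs : x ∉ Metric.closedBall c s₀ := fun hxs =>
      hxr (Metric.closedBall_subset_ball ((hs.trans_le hsr).trans hr) hxs)
    have hx : r ^ 2 ≤ ‖x - c‖ ^ 2 :=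
      pow_le_pow_left₀ (hr₀.trans hr).le (by simpa [dist_eq_norm] using hxr) 2
    rw [Set.indicator_of_notMem hxs, Set.indicator_of_notMem hxr,
      hθ.truncatedPower_eq_zero hx, hθ.eq_zero_of_ge _ hx, zero_mul]

namespace Supercurrent

open SuperAlg

variable {n p : ℕ} {U : Opens (EuclideanSpace ℝ (Fin n))} {T : Supercurrent U}
  {μ : Measure (EuclideanSpace ℝ (Fin n))} {c : EuclideanSpace ℝ (Fin n)}

theorem IsMassMeasure.integral_truncatedPower_le (hμ : T.IsMassMeasure (p + 1) μ)
    (hpos : T.IsPositive (p + 1)) (hclosed : T.d.wedge (beta n ^ p) = 0) {R : ℝ} (hR₀ : 0 ≤ R)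
    (hR : Metric.closedBall c R ⊆ U) {a₀ a b₀ k : ℝ} {θ : ℝ → ℝ}
    (hθ : IsPlateau a₀ a b₀ (R ^ 2) θ) (ha₀ : 0 < a₀) (hk : k = (p + 1) / 2) :
    ∫ x, truncatedPower k (R ^ 2) θ (‖x - c‖ ^ 2) ∂μ ≤
      ∫ x, θ (‖x - c‖ ^ 2) * (‖x - c‖ ^ 2) ^ (-k) ∂μ := by
  have hk₀ : 0 < k := by rw [hk]; positivity
  have hineq := hμ.radial_inequality hpos hclosed hR₀ hR
    (g := fun t => k * (θ t * t ^ (-k - 1 - p))) (h := truncatedPower k (R ^ 2) θ)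
    (contDiff_const.mul (hθ.contDiff_mul_rpow ha₀ _))
    (fun t _ => mul_nonneg hk₀.le (hθ.mul_rpow_nonneg ha₀ _ t))
    (fun t ht => by rw [hθ.eq_zero_of_ge t ht, zero_mul, mul_zero])
    (fun t => (hθ.hasDerivAt_truncatedPower ha₀ k t).congr_deriv <| by
      rw [mul_comm (t ^ p), mul_assoc, hθ.mul_rpow_mul_pow ha₀, sub_add_cancel])
    (fun t ht => hθ.truncatedPower_eq_zero ht)
  have hexp : -k - 1 - (p : ℝ) + ((p + 1 : ℕ) : ℝ) = -k := by push_cast; ring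
  simp only [mul_assoc k, hθ.mul_rpow_mul_pow ha₀, hexp, integral_const_mul] at hineq
  refine le_of_mul_le_mul_left ?_ hk₀
  have : (p : ℝ) + 1 = 2 * k := by rw [hk]; ring
  rw [this] at hineq
  linarith

theorem IsMassMeasure.real_closedBall_div_le (hμ : T.IsMassMeasure (p + 1) μ)
    (hpos : T.IsPositive (p + 1)) (hclosed : T.d.wedge (beta n ^ p) = 0) {s₀ s r₀ r : ℝ}
    (hs₀ : 0 < s₀) (hs : s₀ < s) (hsr : s ≤ r₀) (hr : r₀ < r) (hU : Metric.closedBall c r ⊆ U) :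
    μ.real (Metric.closedBall c s₀) / s ^ (p + 1) ≤ μ.real (Metric.ball c r) / r₀ ^ (p + 1) := by
  have hr₀ : 0 < r₀ := (hs₀.trans hs).trans_le hsr
  have ha₀ : 0 < s₀ ^ 2 := by positivity
  obtain ⟨θ, hθ⟩ := exists_isPlateau (show s₀ ^ 2 < s ^ 2 by gcongr) (show r₀ ^ 2 < r ^ 2 by gcongr)
  let h : 𝓓(U, ℝ) := radialTestFunction c _ (hθ.contDiff_truncatedPower ha₀ ((p + 1 : ℕ) / 2))
    (hr₀.trans hr).le hU fun t ht => hθ.truncatedPower_eq_zero ht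
  let w : 𝓓(U, ℝ) := radialTestFunction c _ (hθ.contDiff_mul_rpow ha₀ (-((p + 1 : ℕ) / 2)))
    (hr₀.trans hr).le hU fun t ht => by rw [hθ.eq_zero_of_ge t ht, zero_mul]
  have hhw : ∫ x, h x ∂μ ≤ ∫ x, w x ∂μ :=
    hμ.integral_truncatedPower_le hpos hclosed (hr₀.trans hr).le hU hθ ha₀ (by push_cast; rfl)
  have hh_int := integrable_testFunction hμ.1 h
  have hw_int := integrable_testFunction hμ.1 w
  have hball : μ (Metric.ball c r) ≠ ⊤ := measure_ne_top_of_subset Metric.ball_subset_closedBall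
    (hμ.1 _ (isCompact_closedBall c r) hU).ne
  have hs_int : Integrable ((Metric.closedBall c s₀).indicator fun _ => (s ^ (p + 1))⁻¹) μ :=
    (integrable_indicator_iff measurableSet_closedBall).2 <| integrableOn_const <|
      measure_ne_top_of_subset
        (Metric.closedBall_subset_ball ((hs.trans_le hsr).trans hr)) hball
  have hr_int : Integrable ((Metric.ball c r).indicator fun _ => (r₀ ^ (p + 1))⁻¹) μ :=
    (integrable_indicator_iff measurableSet_ball).2 (integrableOn_const hball)
  have hle := integral_mono (hs_int.sub hr_int) (hh_int.sub hw_int)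
    (hθ.indicator_sub_indicator_le hs₀ hs hsr hr (p + 1) c)
  simp only [Pi.sub_apply] at hle
  rw [integral_sub hs_int hr_int, integral_sub hh_int hw_int,
    integral_indicator_const _ measurableSet_closedBall,
    integral_indicator_const _ measurableSet_ball] at hle
  simp only [smul_eq_mul, ← div_eq_mul_inv] at hle
  linarith

theorem IsMassMeasure.measure_closedBall_div_le (hμ : T.IsMassMeasure (p + 1) μ)
    (hpos : T.IsPositive (p + 1)) (hclosed : T.d.wedge (beta n ^ p) = 0) {s₀ s r₀ r : ℝ}
    (hs₀ : 0 < s₀) (hs : s₀ < s) (hsr : s ≤ r₀) (hr : r₀ < r) (hU : Metric.ball c r ⊆ U) :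
    μ (Metric.closedBall c s₀) / ENNReal.ofReal (s ^ (p + 1)) ≤
      μ (Metric.ball c r) / ENNReal.ofReal (r₀ ^ (p + 1)) := by
  have hs' : 0 < s := hs₀.trans hs
  have hr₀ : 0 < r₀ := hs'.trans_le hsr
  obtain ⟨r₁, hr₁, hr₁r⟩ := exists_between hr
  have hU₁ : Metric.closedBall c r₁ ⊆ U := (Metric.closedBall_subset_ball hr₁r).trans hU
  have hfinite : μ (Metric.closedBall c r₁) ≠ ⊤ := (hμ.1 _ (isCompact_closedBall c r₁) hU₁).ne
  have hreal := ENNReal.ofReal_le_ofReal (hμ.real_closedBall_div_le hpos hclosed hs₀ hs hsr hr₁ hU₁)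
  rw [ENNReal.ofReal_div_of_pos (by positivity), ENNReal.ofReal_div_of_pos (by positivity),
    ofReal_measureReal (measure_ne_top_of_subset (Metric.closedBall_subset_closedBall
      ((hs.trans_le hsr).trans hr₁).le) hfinite),
    ofReal_measureReal (measure_ne_top_of_subset Metric.ball_subset_closedBall hfinite)] at hreal
  exact hreal.trans (by gcongr)

theorem IsMassMeasure.measure_ball_div_le (hμ : T.IsMassMeasure (p + 1) μ)
    (hpos : T.IsPositive (p + 1)) (hclosed : T.d.wedge (beta n ^ p) = 0) {s r : ℝ}
    (hs : 0 < s) (hsr : s < r) (hU : Metric.ball c r ⊆ U) :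
    μ (Metric.ball c s) / ENNReal.ofReal (s ^ (p + 1)) ≤
      μ (Metric.ball c r) / ENNReal.ofReal (r ^ (p + 1)) := by
  have hs_pow : ENNReal.ofReal (s ^ (p + 1)) ≠ 0 :=
    (ENNReal.ofReal_pos.2 (by positivity)).ne'
  have hle (r₀) (hr₀ : r₀ ∈ Set.Ioo s r) : μ (Metric.ball c s) / ENNReal.ofReal (s ^ (p + 1)) ≤
      μ (Metric.ball c r) / ENNReal.ofReal (r₀ ^ (p + 1)) := by
    refine ENNReal.div_le_of_le_mul (measure_ball_le_of_forall_closedBall_le hs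
      fun t ht hts => ?_)
    exact (ENNReal.div_le_iff hs_pow ENNReal.ofReal_ne_top).1
      (hμ.measure_closedBall_div_le hpos hclosed ht hts hr₀.1.le hr₀.2 hU)
  have hcont : Continuous fun t : ℝ => ENNReal.ofReal (t ^ (p + 1)) :=
    ENNReal.continuous_ofReal.comp (continuous_pow _)
  have hlim := ENNReal.Tendsto.const_div (a := μ (Metric.ball c r))
    ((hcont.tendsto r).mono_left (nhdsWithin_le_nhds (s := Set.Iio r))) (.inl ENNReal.ofReal_ne_top)
  exact ge_of_tendsto hlim (Filter.eventually_of_mem (Ioo_mem_nhdsLT hsr) hle)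

end Supercurrent

theorem theorem6p2_general {n m : ℕ} (hm : 1 ≤ m) {U : Opens (EuclideanSpace ℝ (Fin n))}
    {T : Supercurrent U} (hpos : T.IsPositive m)
    (hclosed : T.d.wedge (SuperAlg.beta n ^ (m - 1)) = 0) (c : EuclideanSpace ℝ (Fin n)) :
    (∃ μ : Measure (EuclideanSpace ℝ (Fin n)), T.IsMassMeasure m μ) ∧
    ∀ μ : Measure (EuclideanSpace ℝ (Fin n)), T.IsMassMeasure m μ →
      MonotoneOn (fun r : ℝ => μ (Metric.ball c r) / ENNReal.ofReal (r ^ m))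
        {r : ℝ | 0 < r ∧ Metric.ball c r ⊆ U} := by
  obtain ⟨p, rfl⟩ := Nat.exists_eq_add_of_le' hm
  refine ⟨hpos.exists_isMassMeasure, fun μ hμ s hs r hr hsr => ?_⟩
  rcases hsr.eq_or_lt with rfl | hlt
  · exact le_rfl
  · exact hμ.measure_ball_div_le hpos hclosed hs.1 hlt hr.2

theorem theorem6p2 (n m : ℕ) (hm : 1 ≤ m) (U : Opens (EuclideanSpace ℝ (Fin n)))
    (h0 : (0 : EuclideanSpace ℝ (Fin n)) ∈ U) (T : Supercurrent U) (hT : T.IsMinimal m) :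
    (∃ μ : Measure (EuclideanSpace ℝ (Fin n)), T.IsMassMeasure m μ) ∧
    ∀ μ : Measure (EuclideanSpace ℝ (Fin n)), T.IsMassMeasure m μ →
      MonotoneOn (fun r : ℝ => μ (Metric.ball 0 r) / ENNReal.ofReal (r ^ m))
        {r : ℝ | 0 < r ∧ Metric.ball (0 : EuclideanSpace ℝ (Fin n)) r ⊆ U} :=
  theorem6p2_general hm hT.isPositive hT.closed 0
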